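/- A \emph{system} $(X,T)$ is a nonempty compact metric space $X$ together with a continuous surjection $T:X\to X$. It is \emph{transitive} if for all nonempty open $U,V\subset X$ there is $n\ge 1$ with $U\cap T^{-n}V\ne\emptyset$; \emph{minimal} if $\{T^nx:n\ge 1\}$ is dense in $X$ for every $x\in X$; and \emph{totally minimal} if $(X,T^n)$ is minimal for every $n\ge 1$. A \emph{minimal set} of $(X,T)$ is a nonempty closed $M\subset X$ with $T(M)\subset M$ such that $(M,T|_M)$ is minimal; it is regarded as a system. A \emph{joining} of $(X,T)$ and $(Y,S)$ is a closed set $J\subset X\times Y$ with $(T\times S)(J)\subset J$ whose projections to $X$ and $Y$ are onto, and $X\perp Y$ ($X$ and $Y$ are \emph{disjoint}) means that $X\times Y$ is the only joining. Let $\mathcal M_{TM}$ be the class of totally minimal systems; $X\perp\mathcal M_{TM}$ means $X\perp Y$ for every $Y\in\mathcal M_{TM}$, and $X\not\perp\mathcal M_{TM}$ is its negation. A \emph{quasifactor} of a minimal system $(N,T)$ is a minimal set of $(2^N,T)$, where $2^N$ is the space of nonempty closed subsets of $N$ with the Hausdorff metric and $T$ acts by $A\mapsto T(A)$. Let $X_{TM}^\perp$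 be the closure in $X$ of $\bigcup\{M\subset X: M \text{ is a minimal set and } M\perp\mathcal M_{TM}\}$. **Theorem D.** Let $(X,T)$ be a transitive system. Then the following are equivalent. 1. $(X,T)\perp\mathcal M_{TM}$. 2. Either there is a sequence of minimal sets $\{M_i\}_{i=1}^\infty$ of $X$ with $\overline{\bigcup_{i=1}^\infty M_i}=X$ such that $M_i\perp\mathcal M_{TM}$ for each $i\in\mathbb N$; or $X_{TM}^\perp$ is nowhere dense and there is a sequence of minimal sets $\{N_i\}_{i=1}^\infty$ of $X$ with $\overline{\bigcup_{i=1}^\infty N_i}=X$ such that, for each $i\in\mathbb N$, $N_i\not\perp\mathcal M_{TM}$ and $X$ is disjoint from every totally minimal quasifactor of $N_i$. -/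

import Mathlib

open Set TopologicalSpace

namespace TopDyn

universe u v

/-- The forward orbit `{Tⁿ x : n ≥ 1}` of `x`. -/
def orbit {X : Type u} (T : X → X) (x : X) : Set X :=
  {y | ∃ n : ℕ, 0 < n ∧ T^[n] x = y}

/-- `(X, T)` is transitive: for all nonempty open `U`, `V` there is `n ≥ 1` such that
`U ∩ T⁻ⁿ V` is nonempty. -/
def IsTransitive {X : Type u} [TopologicalSpace X] (T : X → X) : Prop :=
  ∀ U V : Set X, IsOpen U → U.Nonempty → IsOpen V → V.Nonempty →
    ∃ n : ℕ, 0 < n ∧ (U ∩ T^[n] ⁻¹' V).Nonempty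

/-- `(X, T)` is minimal: every orbit is dense. -/
def IsMinimal {X : Type u} [TopologicalSpace X] (T : X → X) : Prop :=
  ∀ x : X, Dense (orbit T x)

/-- `(X, T)` is totally minimal: `(X, Tⁿ)` is minimal for every `n ≥ 1`
(the case `n = 1` is minimality of `(X, T)`). -/
def IsTotallyMinimal {X : Type u} [TopologicalSpace X] (T : X → X) : Prop :=
  ∀ n : ℕ, 0 < n → IsMinimal (T^[n])

/-- `J` is a joining of `(X, T)` and `(Y, S)`: a closed subset of `X × Y` that is mapped into
itself by `T × S` and projects onto `X` and onto `Y`. -/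
structure IsJoining {X : Type u} {Y : Type v} [TopologicalSpace X] [TopologicalSpace Y]
    (T : X → X) (S : Y → Y) (J : Set (X × Y)) : Prop where
  isClosed : IsClosed J
  mapsTo : MapsTo (Prod.map T S) J J
  fst_image : Prod.fst '' J = univ
  snd_image : Prod.snd '' J = univ

/-- `(X, T)` and `(Y, S)` are disjoint: `X × Y` is their only joining. -/
def Disjoint {X : Type u} {Y : Type v} [TopologicalSpace X] [TopologicalSpace Y]
    (T : X → X) (S : Y → Y) : Prop :=
  ∀ J : Set (X × Y), IsJoining T S J → J = univ

/-- `(X, T)` is disjoint from all totally minimal systems `(Y, S)`, where `Y` is a nonempty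
compact metric space and `S` a continuous surjection. -/
def DisjointFromTM {X : Type u} [TopologicalSpace X] (T : X → X) : Prop :=
  ∀ (Y : Type u) [MetricSpace Y] [CompactSpace Y] [Nonempty Y] (S : C(Y, Y)),
    Function.Surjective S → IsTotallyMinimal S → Disjoint T S

/-- A minimal (sub)set of `(X, T)`: a nonempty closed set `M` with `T M ⊆ M` such that the
restriction of `T` to `M` is minimal. -/
structure MinimalSet {X : Type u} [TopologicalSpace X] (T : C(X, X)) where
  carrier : Set X
  nonempty : carrier.Nonempty
  isClosed : IsClosed carrier
  mapsTo : MapsTo T carrier carrier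
  isMinimal : IsMinimal (mapsTo.restrict T carrier carrier)

/-- The restriction of `T` to a minimal set, as a continuous self-map of the subspace. -/
def MinimalSet.map {X : Type u} [TopologicalSpace X] {T : C(X, X)} (M : MinimalSet T) :
    C(M.carrier, M.carrier) where
  toFun := M.mapsTo.restrict T M.carrier M.carrier
  continuous_toFun := T.continuous.restrict M.mapsTo

/-- The map `A ↦ T A` induced by `T` on the hyperspace `2^X` of nonempty compact (equivalently,
for compact Hausdorff `X`, nonempty closed) subsets of `X`. For metric `X` the topology of
`NonemptyCompacts X` is that of the Hausdorff metric. -/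
def hyper {X : Type u} [TopologicalSpace X] (T : C(X, X)) :
    C(NonemptyCompacts X, NonemptyCompacts X) where
  toFun := NonemptyCompacts.map T T.continuous
  continuous_toFun := T.continuous.nonemptyCompacts_map

/-- A quasifactor of a minimal system `(X, T)`: a minimal set of `(2^X, T)`. -/
abbrev Quasifactor {X : Type u} [TopologicalSpace X] (T : C(X, X)) : Type u :=
  MinimalSet (hyper T)

/-- The set `X_TM^⊥`: the closure of the union of all minimal sets of `(X, T)` that are
disjoint from all totally minimal systems. -/
def tmPerp {X : Type u} [TopologicalSpace X] (T : C(X, X)) : Set X :=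
  closure (⋃ (M : MinimalSet T) (_ : DisjointFromTM M.map), M.carrier)

end TopDyn

/-!
The passage from the second condition to the first rests on two facts about a joining `J` of `X`
with a totally minimal system `Y`. If a minimal set `M` is disjoint from `Y`, then
`M × Y ⊆ J` (`MinimalSet.prod_univ_subset`). If instead `M × Y` is not contained in `J`, then `X`
fails to be disjoint from some totally minimal quasifactor of `M`
(`exists_quasifactor_not_disjoint`). So either condition on a sequence of minimal sets with dense
union forces `J = X × Y`.

The quasifactor comes from the fibres `F y = {x ∈ M | (x, y) ∈ J}`. Ultrafilters on `ℕ` act on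
every compact system by taking limits of `Tⁿ x`, in particular on `2^M`. Let `p` be a minimal
idempotent ultrafilter, `y` a `p`-fixed point of `Y`, `A = p ∘ F y`, and `R` the orbit closure of
`(y, A)` in `Y × 2^M`. Since the elements `p + q + p` form a group, a `p`-fixed point of `R` is
determined by its first coordinate `y'`: it is `(y', p ∘ F y')` (`limAct_fiber_eq`). As `p` also
acts on the sets that are invariant under a power of the map only, this makes `R`, and hence its
projection `Q` to `2^M`, totally minimal. If `X` were disjoint from `Q`, the joining of `X` and `Q`
through `R` and `J` would be everything, and by the same fact every `p`-fixed point of `M` would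
lie in `A`; then `A = M`, and `J` would contain `M × Y`.

For the converse, the closed invariant set `tmPerp T` is nowhere dense or everything, by
transitivity. All that is needed besides separability is that minimal points are dense in `X`
(`DisjointFromTM.exists_minimalSet_inter_nonempty`). If an open set `U` contains none, then the
times at which a transitive point is outside a smaller open set `V` form a thickly syndetic set,
and such a set supports a nonzero point of a totally minimal subshift
(`exists_totallyMinimal_subshift`). The pairs `(x, z)` with `z` supported on the times at which `x`
is outside `V` then form a joining that is not the full product. The subshift is built from words
`c k`, each recurring syndetically in all later ones and, for total minimality, at places in all
residue classes modulo `(k + 1)!` in the next one.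
-/

namespace TopDyn

open Filter Topology

universe u v

/-! ### Minimal systems and minimal sets -/

section Minimal

variable {X : Type u} [TopologicalSpace X] {Y : Type v} [TopologicalSpace Y]

theorem IsMinimal.eq_univ {T : X → X} (hT : IsMinimal T) {C : Set X} (hC : IsClosed C)
    (hne : C.Nonempty) (hinv : MapsTo T C C) : C = univ := by
  obtain ⟨x, hx⟩ := hne
  refine eq_univ_of_univ_subset ?_
  rw [← (hT x).closure_eq]
  refine closure_minimal ?_ hC
  rintro _ ⟨n, -, rfl⟩
  exact hinv.iterate n hx

theorem mapsTo_closure_orbit {T : X → X} (hT : Continuous T) (x : X) :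
    MapsTo T (closure (orbit T x)) (closure (orbit T x)) := by
  refine MapsTo.closure ?_ hT
  rintro _ ⟨n, hn, rfl⟩
  exact ⟨n + 1, n.succ_pos, Function.iterate_succ_apply' T n x⟩

omit [TopologicalSpace X] in
theorem orbit_nonempty (T : X → X) (x : X) : (orbit T x).Nonempty :=
  ⟨T^[1] x, 1, one_pos, rfl⟩

theorem isMinimal_of_forall_isClosed {T : X → X} (hT : Continuous T)
    (h : ∀ C : Set X, IsClosed C → C.Nonempty → MapsTo T C C → C = univ) : IsMinimal T := by
  intro x
  rw [dense_iff_closure_eq]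
  exact h _ isClosed_closure (orbit_nonempty T x).closure (mapsTo_closure_orbit hT x)

theorem IsTotallyMinimal.isMinimal {T : X → X} (hT : IsTotallyMinimal T) : IsMinimal T := by
  simpa using hT 1 one_pos

theorem IsMinimal.surjective [CompactSpace X] [T2Space X] [Nonempty X] {T : X → X}
    (hT : IsMinimal T) (hc : Continuous T) : Function.Surjective T := by
  rw [← range_eq_univ]
  refine hT.eq_univ (isCompact_range hc).isClosed (range_nonempty T) ?_
  rintro _ -
  exact mem_range_self _

/-- Existence of minimal closed invariant sets, by Zorn's lemma. -/
theorem exists_minimal_closed_invariant [CompactSpace X] (T : X → X) {C : Set X}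
    (hC : IsClosed C) (hne : C.Nonempty) (hinv : MapsTo T C C) :
    ∃ M ⊆ C, IsClosed M ∧ M.Nonempty ∧ MapsTo T M M ∧
      ∀ M' ⊆ M, IsClosed M' → M'.Nonempty → MapsTo T M' M' → M' = M := by
  obtain ⟨M, hMC, hM⟩ := zorn_superset_nonempty
    {D : Set X | IsClosed D ∧ D.Nonempty ∧ MapsTo T D D} (fun c hc hchain hcne => by
      refine ⟨⋂₀ c, ⟨isClosed_sInter fun D hD => (hc hD).1, ?_, ?_⟩,
        fun D hD => sInter_subset_of_mem hD⟩
      · have : Nonempty c := hcne.to_subtype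
        rw [sInter_eq_iInter]
        exact IsCompact.nonempty_iInter_of_directed_nonempty_isCompact_isClosed _
          (DirectedOn.directed_val (IsChain.directedOn hchain.symm))
          (fun D => (hc D.2).2.1) (fun D => (hc D.2).1.isCompact) (fun D => (hc D.2).1)
      · intro x hx
        rw [mem_sInter] at hx ⊢
        exact fun D hD => (hc hD).2.2 (hx D hD)) C ⟨hC, hne, hinv⟩
  exact ⟨M, hMC, hM.prop.1, hM.prop.2.1, hM.prop.2.2,
    fun M' hM' h1 h2 h3 => hM.eq_of_subset ⟨h1, h2, h3⟩ hM'⟩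

theorem exists_minimalSet_subset [CompactSpace X] (T : C(X, X)) {C : Set X}
    (hC : IsClosed C) (hne : C.Nonempty) (hinv : MapsTo T C C) :
    ∃ M : MinimalSet T, M.carrier ⊆ C := by
  obtain ⟨M, hMC, hcl, hMne, hMT, hmin⟩ := exists_minimal_closed_invariant T hC hne hinv
  refine ⟨⟨M, hMne, hcl, hMT, isMinimal_of_forall_isClosed (T.continuous.restrict hMT) ?_⟩, hMC⟩
  intro D hD hDne hDinv
  have : (Subtype.val '' D) = M := by
    refine hmin _ ?_ (hcl.isClosedEmbedding_subtypeVal.isClosedMap _ hD) (hDne.image _) ?_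
    · rintro _ ⟨x, -, rfl⟩
      exact x.2
    · rintro _ ⟨x, hx, rfl⟩
      exact ⟨_, hDinv hx, rfl⟩
  refine eq_univ_of_forall fun x => ?_
  obtain ⟨z, hz, hzx⟩ : (x : X) ∈ Subtype.val '' D := this.symm.subset x.2
  rwa [← Subtype.ext hzx]

instance MinimalSet.compactSpace [CompactSpace X] {T : C(X, X)} (M : MinimalSet T) :
    CompactSpace M.carrier :=
  isCompact_iff_compactSpace.mp M.isClosed.isCompact

instance MinimalSet.nonempty_carrier {T : C(X, X)} (M : MinimalSet T) : Nonempty M.carrier :=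
  M.nonempty.to_subtype

theorem MinimalSet.isMinimal_map {T : C(X, X)} (M : MinimalSet T) : IsMinimal M.map :=
  M.isMinimal

/-- A closed invariant set over a minimal second factor is a joining as soon as it projects onto
the first factor. -/
theorem isJoining_of_isMinimal [CompactSpace X] [CompactSpace Y] [T2Space Y] [Nonempty X]
    {T : X → X} {S : Y → Y} (hS : IsMinimal S)
    {J : Set (X × Y)} (hJ : IsClosed J) (hinv : MapsTo (Prod.map T S) J J)
    (hfst : Prod.fst '' J = univ) : IsJoining T S J where
  isClosed := hJ
  mapsTo := hinv
  fst_image := hfst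
  snd_image := by
    refine hS.eq_univ (hJ.isCompact.image continuous_snd).isClosed ?_ ?_
    · have : (Prod.fst '' J).Nonempty := hfst ▸ univ_nonempty
      exact this.of_image.image _
    · rintro _ ⟨z, hz, rfl⟩
      exact ⟨_, hinv hz, rfl⟩

end Minimal

/-! ### The action of ultrafilters on compact systems -/

section Action

attribute [local instance] Ultrafilter.add Ultrafilter.addSemigroup

variable {X : Type u} [TopologicalSpace X] [CompactSpace X] [T2Space X]
  {Y : Type v} [TopologicalSpace Y] [CompactSpace Y] [T2Space Y]

/-- The action of the ultrafilter `p` on the system `(X, T)`: the limit of `Tⁿ x` along `p`. -/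
noncomputable def limAct (T : X → X) (p : Ultrafilter ℕ) (x : X) : X :=
  Ultrafilter.extend (fun n => T^[n] x) p

theorem tendsto_limAct (T : X → X) (p : Ultrafilter ℕ) (x : X) :
    Tendsto (fun n => T^[n] x) p (𝓝 (limAct T p x)) := by
  have := (ultrafilter_extend_eq_iff (f := fun n => T^[n] x) (b := p) (c := limAct T p x)).1 rfl
  simpa [Tendsto] using this

theorem limAct_eq {T : X → X} {p : Ultrafilter ℕ} {x y : X}
    (h : Tendsto (fun n => T^[n] x) p (𝓝 y)) : limAct T p x = y :=
  tendsto_nhds_unique (tendsto_limAct T p x) h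

theorem limAct_mem_of_eventually {T : X → X} {p : Ultrafilter ℕ} {x : X} {C : Set X}
    (hC : IsClosed C) (h : ∀ᶠ n in p, T^[n] x ∈ C) : limAct T p x ∈ C :=
  hC.mem_of_tendsto (tendsto_limAct T p x) h

theorem limAct_mem {T : X → X} (p : Ultrafilter ℕ) {x : X} {C : Set X} (hC : IsClosed C)
    (hinv : MapsTo T C C) (hx : x ∈ C) : limAct T p x ∈ C :=
  limAct_mem_of_eventually hC (.of_forall fun n => hinv.iterate n hx)

theorem map_limAct {T : X → X} {S : Y → Y} {φ : X → Y} (hφ : Continuous φ)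
    (h : Function.Semiconj φ T S) (p : Ultrafilter ℕ) (x : X) :
    φ (limAct T p x) = limAct S p (φ x) := by
  refine (limAct_eq ?_).symm
  have := (hφ.tendsto _).comp (tendsto_limAct T p x)
  refine this.congr fun n => ?_
  exact (h.iterate_right n) x

theorem limAct_prodMap (T : X → X) (S : Y → Y) (p : Ultrafilter ℕ) (z : X × Y) :
    limAct (Prod.map T S) p z = (limAct T p z.1, limAct S p z.2) :=
  Prod.ext (map_limAct continuous_fst (fun _ => rfl) p z)
    (map_limAct continuous_snd (fun _ => rfl) p z)

theorem limAct_pure (T : X → X) (n : ℕ) (x : X) : limAct T (pure n) x = T^[n] x :=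
  limAct_eq (tendsto_pure_nhds _ _)

theorem limAct_iterate {T : X → X} (hT : Continuous T) (p : Ultrafilter ℕ) (m : ℕ) (x : X) :
    limAct T p (T^[m] x) = T^[m] (limAct T p x) :=
  (map_limAct (hT.iterate m) (Function.Commute.iterate_self T m) p x).symm

theorem limAct_add {T : X → X} (hT : Continuous T) (p q : Ultrafilter ℕ) (x : X) :
    limAct T (p + q) x = limAct T p (limAct T q x) := by
  refine limAct_eq ?_
  rw [(closed_nhds_basis _).tendsto_right_iff]
  rintro C ⟨hC, hCcl⟩
  have h := (tendsto_limAct T p (limAct T q x)) (interior_mem_nhds.2 hC)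
  have h' : ∀ᶠ m in (p : Filter ℕ), T^[m] (limAct T q x) ∈ interior C := h
  refine (Ultrafilter.eventually_add p q (fun n => T^[n] x ∈ C)).2 ?_
  filter_upwards [h'] with m hm
  have h2 := ((hT.iterate m).tendsto _).comp (tendsto_limAct T q x)
  filter_upwards [h2 (isOpen_interior.mem_nhds hm)] with n hn
  rw [Function.iterate_add_apply]
  exact interior_subset hn

theorem exists_limAct_eq {T : X → X} {x y : X} (h : y ∈ closure (orbit T x)) :
    ∃ q : Ultrafilter ℕ, limAct T q x = y := by
  have hne : (comap (fun n => T^[n] x) (𝓝 y)).NeBot := by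
    rw [comap_neBot_iff]
    intro t ht
    obtain ⟨_, ht', n, -, rfl⟩ := mem_closure_iff_nhds.1 h t ht
    exact ⟨n, ht'⟩
  refine ⟨Ultrafilter.of (comap (fun n => T^[n] x) (𝓝 y)), limAct_eq ?_⟩
  exact tendsto_comap.mono_left (Ultrafilter.of_le _)

theorem continuous_ultrafilter_add_right (q : Ultrafilter ℕ) : Continuous (· + q) :=
  Ultrafilter.continuous_add_left q

/-- A minimal idempotent of the semigroup of ultrafilters on `ℕ`: an idempotent that lies in a
minimal left ideal. -/
structure IsMinimalIdempotent (p : Ultrafilter ℕ) : Prop where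
  idem : p + p = p
  exists_add : ∀ q : Ultrafilter ℕ, ∃ r : Ultrafilter ℕ, r + (q + p) = p

theorem pure_zero_add (q : Ultrafilter ℕ) : pure 0 + q = q := by
  ext s
  have := Ultrafilter.eventually_add (pure 0) q (fun n => n ∈ s)
  rw [Ultrafilter.coe_pure, eventually_pure] at this
  simpa using this

theorem pure_add_pure (a b : ℕ) : (pure a + pure b : Ultrafilter ℕ) = pure (a + b) := by
  ext s
  have := Ultrafilter.eventually_add (pure a) (pure b) (fun n => n ∈ s)
  simp only [Ultrafilter.coe_pure, eventually_pure] at this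
  exact this.trans (by simp)

/-- A minimal left ideal is a minimal closed set invariant under `q ↦ 1 + q`; as a compact
semigroup it contains an idempotent. -/
theorem exists_isMinimalIdempotent : ∃ p : Ultrafilter ℕ, IsMinimalIdempotent p := by
  obtain ⟨L, -, hcl, hne, hinv, hmin⟩ := exists_minimal_closed_invariant
    (fun q : Ultrafilter ℕ => pure 1 + q) isClosed_univ univ_nonempty (mapsTo_univ _ _)
  -- `L` is stable under adding any ultrafilter on the left, by density of the principal ones.
  have hL : ∀ r : Ultrafilter ℕ, ∀ q ∈ L, r + q ∈ L := by
    intro r q hq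
    have hclosed : IsClosed {r : Ultrafilter ℕ | r + q ∈ L} :=
      hcl.preimage (continuous_ultrafilter_add_right q)
    refine hclosed.closure_subset_iff.2 ?_ (denseRange_pure r)
    rintro _ ⟨n, rfl⟩
    induction n with
    | zero => exact (pure_zero_add q).symm.subst (motive := (· ∈ L)) hq
    | succ n ih =>
      have h : (pure (n + 1) + q : Ultrafilter ℕ) = pure 1 + (pure n + q) := by
        rw [← add_assoc, pure_add_pure, add_comm]
      exact h.symm.subst (motive := (· ∈ L)) (hinv ih)
  obtain ⟨p, hp, hpp⟩ := exists_idempotent_in_compact_add_subsemigroup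
    continuous_ultrafilter_add_right L hne hcl.isCompact (fun x _ y hy => hL x y hy)
  refine ⟨p, hpp, fun q => ?_⟩
  have h := hmin (range fun r => r + (q + p)) ?_
    (isCompact_range (continuous_ultrafilter_add_right _)).isClosed (range_nonempty _) ?_
  · exact h.symm.subset hp
  · rintro _ ⟨r, rfl⟩
    exact hL _ _ (hL _ _ hp)
  · rintro _ ⟨r, rfl⟩
    exact ⟨pure 1 + r, add_assoc _ _ _⟩

/-- An idempotent ultrafilter contains every set `nℕ`: its image in the finite group `ℤ/n` is
an idempotent, that is `0`. -/
theorem eventually_dvd_of_idem {p : Ultrafilter ℕ} (hp : p + p = p) {n : ℕ} (hn : 0 < n) :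
    ∀ᶠ m in (p : Filter ℕ), n ∣ m := by
  have : NeZero n := ⟨hn.ne'⟩
  obtain ⟨a, ha⟩ : ∃ a : ZMod n, ∀ᶠ m : ℕ in (p : Filter ℕ), ((m : ℕ) : ZMod n) = a := by
    rw [← Ultrafilter.eventually_exists_iff]
    exact .of_forall fun m => ⟨_, rfl⟩
  have h2 : ∀ᶠ m : ℕ in (p : Filter ℕ), ((m : ℕ) : ZMod n) = a + a := by
    rw [← hp]
    refine (Ultrafilter.eventually_add p p (fun m => ((m : ℕ) : ZMod n) = a + a)).2 ?_
    filter_upwards [ha] with m hm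
    filter_upwards [ha] with m' hm'
    push_cast
    rw [hm, hm']
  obtain ⟨m, hm, hm'⟩ := (ha.and h2).exists
  have ha0 : a = 0 := by
    have := hm.symm.trans hm'
    simpa using this
  filter_upwards [ha] with m hm
  rwa [ha0, ZMod.natCast_eq_zero_iff] at hm

end Action

/-! ### Totally minimal quasifactors from joinings -/

section Hyper

variable {X : Type u} [TopologicalSpace X] [T2Space X]
  {Y : Type v} [TopologicalSpace Y]

theorem isClosed_setOf_mem_nonemptyCompacts :
    IsClosed {z : X × NonemptyCompacts X | z.1 ∈ z.2} := by
  have h := (NonemptyCompacts.isOpen_setOfPred_disjoint_coe (α := X)).preimage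
    ((NonemptyCompacts.continuous_singleton (α := X)).prodMap continuous_id)
  rw [← isOpen_compl_iff]
  convert h using 1
  ext z
  simp [Prod.map, Set.disjoint_left]

theorem isClosed_setOf_le_nonemptyCompacts :
    IsClosed {z : NonemptyCompacts X × NonemptyCompacts X | z.1 ≤ z.2} := by
  simp only [← sup_eq_right]
  exact isClosed_eq (continuous_fst.sup continuous_snd) continuous_snd

omit [T2Space X] in
theorem isClosed_setOf_prod_subset {J : Set (X × Y)} (hJ : IsClosed J) :
    IsClosed {z : Y × NonemptyCompacts X | ∀ x ∈ z.2, (x, z.1) ∈ J} := by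
  have h := (NonemptyCompacts.isClosed_subsets_of_isClosed hJ).preimage
    ((NonemptyCompacts.continuous_prod (α := X) (β := Y)).comp
      (continuous_snd.prodMk (NonemptyCompacts.continuous_singleton.comp continuous_fst)))
  convert h using 1
  ext z
  simp only [mem_ofPred_eq, mem_preimage, Function.comp_apply, Set.subset_def,
    NonemptyCompacts.coe_prod]
  exact ⟨fun h w hw => (show w = (w.1, z.1) from Prod.ext rfl hw.2) ▸ h w.1 hw.1,
    fun h x hx => h (x, z.1) ⟨hx, rfl⟩⟩

variable [CompactSpace X] [CompactSpace Y] [T2Space Y] (T : C(X, X))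

theorem limAct_mem_hyper (p : Ultrafilter ℕ) {x : X} {C : NonemptyCompacts X} (h : x ∈ C) :
    limAct T p x ∈ limAct (hyper T) p C := by
  have := limAct_mem (T := Prod.map T (hyper T)) p (x := (x, C))
    isClosed_setOf_mem_nonemptyCompacts (fun z hz => mem_image_of_mem T hz) h
  rwa [limAct_prodMap] at this

theorem limAct_hyper_mono (p : Ultrafilter ℕ) {C D : NonemptyCompacts X} (h : C ≤ D) :
    limAct (hyper T) p C ≤ limAct (hyper T) p D := by
  have := limAct_mem (T := Prod.map (hyper T) (hyper T)) p (x := (C, D))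
    isClosed_setOf_le_nonemptyCompacts
    (fun z (hz : z.1 ≤ z.2) => (image_mono hz : T '' z.1 ⊆ T '' z.2)) h
  rwa [limAct_prodMap] at this

omit [CompactSpace X] [T2Space X] [TopologicalSpace Y] [CompactSpace Y] [T2Space Y] in
theorem mapsTo_setOf_prod_subset {S : Y → Y} {J : Set (X × Y)} (hJ : MapsTo (Prod.map T S) J J) :
    MapsTo (Prod.map S (hyper T)) {z : Y × NonemptyCompacts X | ∀ x ∈ z.2, (x, z.1) ∈ J}
      {z : Y × NonemptyCompacts X | ∀ x ∈ z.2, (x, z.1) ∈ J} := by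
  rintro z hz _ ⟨x, hx, rfl⟩
  exact hJ (hz x hx)

end Hyper

section Algebra

attribute [local instance] Ultrafilter.add Ultrafilter.addSemigroup

/-- For a minimal idempotent `p`, the elements `p + q + p` form a group with identity `p`. -/
theorem IsMinimalIdempotent.exists_inverse {p : Ultrafilter ℕ} (hp : IsMinimalIdempotent p)
    (q : Ultrafilter ℕ) : ∃ r, r + (p + q + p) = p ∧ (p + q + p) + r = p := by
  have left (q : Ultrafilter ℕ) : ∃ r, (p + r + p) + (p + q + p) = p := by
    obtain ⟨r, hr⟩ := hp.exists_add (p + q)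
    refine ⟨r, ?_⟩
    calc (p + r + p) + (p + q + p) = p + (r + ((p + p) + q + p)) := by simp only [add_assoc]
      _ = p := by rw [hp.idem, hr, hp.idem]
  obtain ⟨r, hr⟩ := left q
  obtain ⟨s, hs⟩ := left r
  have hsq : p + s + p = p + q + p := by
    calc p + s + p = p + s + (p + p) := by rw [hp.idem]
      _ = (p + s + p) + ((p + r + p) + (p + q + p)) := by rw [hr]; simp only [add_assoc]
      _ = ((p + s + p) + (p + r + p)) + (p + q + p) := by simp only [add_assoc]
      _ = (p + p) + q + p := by rw [hs]; simp only [add_assoc]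
      _ = p + q + p := by rw [hp.idem]
  exact ⟨p + r + p, hr, hsq ▸ hs⟩

end Algebra

section Fiber

attribute [local instance] Ultrafilter.add Ultrafilter.addSemigroup

variable {X : Type u} [TopologicalSpace X] [CompactSpace X] [T2Space X]
  {Y : Type v} [TopologicalSpace Y] [CompactSpace Y] [T2Space Y]
  (T : C(X, X)) (S : C(Y, Y))

/-- `F y` is the fibre over `y` of a closed invariant set `J ⊆ X × Y`. If `y` is fixed by the
minimal idempotent `p`, then every `p`-fixed pair `(y', B)` in the orbit closure of
`(y, p ∘ F y)` is determined by `y'`: it satisfies `B = p ∘ F y'`. -/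
theorem limAct_fiber_eq {J : Set (X × Y)} (hJ : IsClosed J) (hinv : MapsTo (Prod.map T S) J J)
    {F : Y → NonemptyCompacts X} (hF : ∀ x y, x ∈ F y ↔ (x, y) ∈ J)
    {p : Ultrafilter ℕ} (hp : IsMinimalIdempotent p) {y : Y} (hy : limAct S p y = y)
    {y' : Y} {B : NonemptyCompacts X}
    (hR : (y', B) ∈ closure (orbit (Prod.map S (hyper T)) (y, limAct (hyper T) p (F y))))
    (hy' : limAct S p y' = y') (hB : limAct (hyper T) p B = B) :
    B = limAct (hyper T) p (F y') := by
  have hS := S.continuous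
  have hT := (hyper T).continuous
  have hle (q : Ultrafilter ℕ) {z : Y} {C : NonemptyCompacts X} (hC : C ≤ F z) :
      limAct (hyper T) q C ≤ F (limAct S q z) := by
    have := limAct_mem q (x := (z, C)) (isClosed_setOf_prod_subset hJ)
      (mapsTo_setOf_prod_subset T hinv) (fun x hx => (hF x z).1 (hC hx))
    rw [limAct_prodMap] at this
    exact fun x hx => (hF _ _).2 (this x hx)
  obtain ⟨q, hq⟩ := exists_limAct_eq hR
  rw [limAct_prodMap, Prod.mk.injEq] at hq
  obtain ⟨hqy, hqB⟩ := hq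
  dsimp only at hqy hqB
  apply le_antisymm
  · rw [← hB]
    refine limAct_hyper_mono T p ?_
    rw [← hqB, ← hqy]
    have := hle p (le_refl (F y))
    rw [hy] at this
    exact hle q this
  · obtain ⟨r, hr, hr'⟩ := hp.exists_inverse q
    have hgy : limAct S (p + q + p) y = y' := by
      rw [limAct_add hS, limAct_add hS, hy, hqy, hy']
    have hgB : limAct (hyper T) (p + q + p) (F y) = B := by
      rw [limAct_add hT, limAct_add hT, hqB, hB]
    have hry : limAct S r y' = y := by
      rw [← hgy, ← limAct_add hS, hr, hy]
    calc limAct (hyper T) p (F y')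
        = limAct (hyper T) (p + q + p) (limAct (hyper T) r (F y')) := by
          rw [← limAct_add hT, hr']
      _ ≤ limAct (hyper T) (p + q + p) (F (limAct S r y')) :=
          limAct_hyper_mono T _ (hle r le_rfl)
      _ = B := by rw [hry, hgB]

/-- For `p` idempotent, a closed set invariant under some power of `T` is invariant under `p`. -/
theorem limAct_mem_of_iterate {T : X → X} {p : Ultrafilter ℕ} (hp : p + p = p) {n : ℕ}
    (hn : 0 < n) {C : Set X} (hC : IsClosed C) (hinv : MapsTo T^[n] C C) {x : X} (hx : x ∈ C) :
    limAct T p x ∈ C := by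
  refine limAct_mem_of_eventually hC ?_
  filter_upwards [eventually_dvd_of_idem hp hn] with m hm
  obtain ⟨k, rfl⟩ := hm
  rw [Function.iterate_mul]
  exact hinv.iterate k hx

/-- The orbit closure of `(y, p ∘ F y)` is totally minimal when `(Y, S)` is. -/
theorem subset_closure_orbit_iterate {J : Set (X × Y)} (hJ : IsClosed J)
    (hinv : MapsTo (Prod.map T S) J J)
    {F : Y → NonemptyCompacts X} (hF : ∀ x y, x ∈ F y ↔ (x, y) ∈ J)
    {p : Ultrafilter ℕ} (hp : IsMinimalIdempotent p) {y : Y} (hy : limAct S p y = y)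
    (hS : IsTotallyMinimal S) {n : ℕ} (hn : 0 < n) {z : Y × NonemptyCompacts X}
    (hz : z ∈ closure (orbit (Prod.map S (hyper T)) (y, limAct (hyper T) p (F y)))) :
    closure (orbit (Prod.map S (hyper T)) (y, limAct (hyper T) p (F y))) ⊆
      closure (orbit (Prod.map S (hyper T))^[n] z) := by
  have hSc := S.continuous
  have hTc := (hyper T).continuous
  set Φ := Prod.map S (hyper T) with hΦ
  have hΦc : Continuous Φ := hSc.prodMap hTc
  set A := limAct (hyper T) p (F y) with hA
  have hpA : limAct (hyper T) p A = A := by rw [hA, ← limAct_add hTc, hp.idem]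
  have hRinv := mapsTo_closure_orbit hΦc (y, A)
  have hZinv := mapsTo_closure_orbit (hΦc.iterate n) z
  have hZR : closure (orbit Φ^[n] z) ⊆ closure (orbit Φ (y, A)) := by
    refine closure_minimal ?_ isClosed_closure
    rintro _ ⟨k, -, rfl⟩
    exact (hRinv.iterate n).iterate k hz
  have hfst : Prod.fst '' closure (orbit Φ^[n] z) = univ := by
    refine (hS n hn).eq_univ (isClosed_closure.isCompact.image continuous_fst).isClosed
      ((orbit_nonempty _ _).closure.image _) ?_
    rintro _ ⟨w, hw, rfl⟩
    refine ⟨_, hZinv hw, ?_⟩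
    rw [hΦ, Prod.map_iterate]
    rfl
  refine closure_minimal ?_ isClosed_closure
  rintro _ ⟨m, hm, rfl⟩
  -- Both `Φ^m (y, A)` and `p · w` are `p`-fixed points of the orbit closure over `S^m y`.
  obtain ⟨w, hw, hwy⟩ := hfst.symm.subset (mem_univ (S^[m] y))
  have hpw := limAct_mem_of_iterate hp.idem hn isClosed_closure hZinv hw
  rw [hΦ, limAct_prodMap, hwy, limAct_iterate hSc, hy, ← hΦ] at hpw
  have hfix : limAct S p (S^[m] y) = S^[m] y := by rw [limAct_iterate hSc, hy]
  have h1 := limAct_fiber_eq T S hJ hinv hF hp hy (hZR hpw) hfix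
    (by rw [← limAct_add hTc, hp.idem])
  have hmem : (S^[m] y, (hyper T)^[m] A) ∈ closure (orbit Φ (y, A)) := by
    refine subset_closure ⟨m, hm, ?_⟩
    rw [hΦ, Prod.map_iterate]
    rfl
  have h2 := limAct_fiber_eq T S hJ hinv hF hp hy hmem hfix
    (by rw [limAct_iterate hTc, hpA])
  rw [h1, ← h2] at hpw
  have hm : Φ^[m] (y, A) = (S^[m] y, (hyper T)^[m] A) := by
    rw [hΦ, Prod.map_iterate]
    rfl
  rwa [hm]

end Fiber

section Quasifactor

attribute [local instance] Ultrafilter.add Ultrafilter.addSemigroup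

variable {X : Type u} [TopologicalSpace X]

theorem MinimalSet.isTotallyMinimal_of_subset_closure {T : C(X, X)} (M : MinimalSet T)
    (h : ∀ n, 0 < n → ∀ x ∈ M.carrier, M.carrier ⊆ closure (orbit T^[n] x)) :
    IsTotallyMinimal M.map := by
  intro n hn x
  rw [Subtype.dense_iff]
  refine (h n hn x x.2).trans (closure_mono ?_)
  rintro _ ⟨k, hk, rfl⟩
  refine ⟨_, ⟨k, hk, rfl⟩, ?_⟩
  have hsemi : Function.Semiconj (Subtype.val : M.carrier → X) M.map T := fun _ => rfl
  exact (hsemi.iterate_right n).iterate_right k x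

variable [CompactSpace X] [T2Space X] [Nonempty X]
  {Y : Type v} [TopologicalSpace Y] [CompactSpace Y] [T2Space Y] [Nonempty Y]

/-- If some joining of `X` with a totally minimal system does not contain `M × Y`, for `M` a
minimal set of `X`, then `X` fails to be disjoint from some totally minimal quasifactor of `M`. -/
theorem exists_quasifactor_not_disjoint {T : C(X, X)} (M : MinimalSet T) {S : C(Y, Y)}
    (hS : IsTotallyMinimal S) {J : Set (X × Y)} (hJ : IsJoining T S J)
    (hne : ¬ M.carrier ×ˢ univ ⊆ J) :
    ∃ Q : Quasifactor M.map, IsTotallyMinimal Q.map ∧ ¬ Disjoint T Q.map := by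
  have hSc := S.continuous
  have hTc := (hyper M.map).continuous
  -- The restriction of `J` to `M × Y`, and its fibres over `Y`.
  set JM : Set (M.carrier × Y) := {z | ((z.1 : X), z.2) ∈ J} with hJM
  have hJMcl : IsClosed JM := hJ.isClosed.preimage (by fun_prop)
  have hJMinv : MapsTo (Prod.map M.map S) JM JM := fun z hz => hJ.mapsTo hz
  have hsnd : Prod.snd '' JM = univ := by
    refine hS.isMinimal.eq_univ (hJMcl.isCompact.image continuous_snd).isClosed ?_ ?_
    · obtain ⟨x, hx⟩ := M.nonempty
      obtain ⟨z, hz, rfl⟩ := hJ.fst_image.symm.subset (mem_univ x)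
      exact ⟨z.2, (⟨z.1, hx⟩, z.2), hz, rfl⟩
    · rintro _ ⟨z, hz, rfl⟩
      exact ⟨_, hJMinv hz, rfl⟩
  let F : Y → NonemptyCompacts M.carrier := fun y =>
    { carrier := {x | (x, y) ∈ JM}
      isCompact' := (hJMcl.preimage (Continuous.prodMk_left y)).isCompact
      nonempty' := by
        obtain ⟨z, hz, rfl⟩ := hsnd.symm.subset (mem_univ y)
        exact ⟨z.1, hz⟩ }
  have hF : ∀ x y, x ∈ F y ↔ (x, y) ∈ JM := fun x y => Iff.rfl
  obtain ⟨p, hp⟩ := exists_isMinimalIdempotent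
  obtain ⟨y₀⟩ := ‹Nonempty Y›
  obtain ⟨y, hy⟩ : ∃ y, limAct S p y = y :=
    ⟨limAct S p y₀, by rw [← limAct_add hSc, hp.idem]⟩
  set A := limAct (hyper M.map) p (F y) with hA
  have hpA : limAct (hyper M.map) p A = A := by rw [hA, ← limAct_add hTc, hp.idem]
  set Φ := Prod.map S (hyper M.map) with hΦ
  have hΦc : Continuous Φ := hSc.prodMap hTc
  set R := closure (orbit Φ (y, A)) with hR
  have hRcl : IsClosed R := isClosed_closure
  have hRinv : MapsTo Φ R R := mapsTo_closure_orbit hΦc _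
  have hRmin : ∀ n, 0 < n → ∀ z ∈ R, R ⊆ closure (orbit Φ^[n] z) := fun n hn z hz =>
    subset_closure_orbit_iterate M.map S hJMcl hJMinv hF hp hy hS hn hz
  have hyA : (y, A) ∈ R := by
    -- `p = r + (1 + p)` for some `r`, so the `p`-fixed point `(y, A)` is a limit of its orbit.
    obtain ⟨r, hr⟩ := hp.exists_add (pure 1)
    have hpyA : limAct Φ p (y, A) = (y, A) := by rw [hΦ, limAct_prodMap, hy, hpA]
    have h1 : Φ (y, A) ∈ R := subset_closure ⟨1, one_pos, rfl⟩
    have h2 : limAct Φ r (Φ (y, A)) = (y, A) := by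
      conv_rhs => rw [← hpyA, ← hr, limAct_add hΦc, limAct_add hΦc, hpyA, limAct_pure]
      rfl
    exact h2 ▸ limAct_mem r hRcl hRinv h1
  have hQmin : ∀ n, 0 < n → ∀ B ∈ Prod.snd '' R,
      Prod.snd '' R ⊆ closure (orbit (hyper M.map)^[n] B) := by
    rintro n hn _ ⟨z, hz, rfl⟩
    refine (image_mono (hRmin n hn z hz)).trans ((image_closure_subset_closure_image
      continuous_snd).trans (closure_mono ?_))
    rintro _ ⟨_, ⟨k, hk, rfl⟩, rfl⟩
    refine ⟨k, hk, ?_⟩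
    rw [hΦ, Prod.map_iterate, Prod.map_iterate]
    rfl
  have hQcl : IsClosed (Prod.snd '' R) := (hRcl.isCompact.image continuous_snd).isClosed
  have hQinv : MapsTo (hyper M.map) (Prod.snd '' R) (Prod.snd '' R) := by
    rintro _ ⟨z, hz, rfl⟩
    exact ⟨_, hRinv hz, rfl⟩
  let Q : Quasifactor M.map :=
    { carrier := Prod.snd '' R
      nonempty := ⟨A, _, hyA, rfl⟩
      isClosed := hQcl
      mapsTo := hQinv
      isMinimal := by
        intro B
        rw [Subtype.dense_iff]
        refine (hQmin 1 one_pos B B.2).trans (closure_mono ?_)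
        rintro _ ⟨k, hk, rfl⟩
        refine ⟨_, ⟨k, hk, rfl⟩, ?_⟩
        have hsemi : Function.Semiconj (Subtype.val : (Prod.snd '' R) → _)
          (hQinv.restrict _ _ _) (hyper M.map) := fun _ => rfl
        exact hsemi.iterate_right k B }
  have hQTM : IsTotallyMinimal Q.map := Q.isTotallyMinimal_of_subset_closure hQmin
  refine ⟨Q, hQTM, fun hdisj => hne ?_⟩
  have hQcomp : CompactSpace Q.carrier := isCompact_iff_compactSpace.mp hQcl.isCompact
  -- The joining of `X` and `Q` induced by `J`.
  have hfull : {z : X × Q.carrier | ∃ y', (y', (z.2 : NonemptyCompacts M.carrier)) ∈ R ∧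
      (z.1, y') ∈ J} = univ := by
    refine hdisj _ (isJoining_of_isMinimal Q.isMinimal_map ?_ ?_ ?_)
    · have hcl : IsClosed {w : Y × (X × Q.carrier) |
          (w.1, (w.2.2 : NonemptyCompacts M.carrier)) ∈ R ∧ (w.2.1, w.1) ∈ J} :=
        (hRcl.preimage (by fun_prop)).inter (hJ.isClosed.preimage (by fun_prop))
      convert (hcl.isCompact.image continuous_snd).isClosed using 1
      ext z
      constructor
      · rintro ⟨y', h⟩
        exact ⟨(y', z), h, rfl⟩
      · rintro ⟨⟨y', _⟩, h, rfl⟩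
        exact ⟨y', h⟩
    · rintro z ⟨y', h1, h2⟩
      exact ⟨S y', hRinv h1, hJ.mapsTo h2⟩
    · have hRfst : Prod.fst '' R = univ := by
        refine hS.isMinimal.eq_univ (hRcl.isCompact.image continuous_fst).isClosed
          ⟨y, _, hyA, rfl⟩ ?_
        rintro _ ⟨z, hz, rfl⟩
        exact ⟨_, hRinv hz, rfl⟩
      refine eq_univ_of_forall fun x => ?_
      obtain ⟨z, hz, rfl⟩ := hJ.fst_image.symm.subset (mem_univ x)
      obtain ⟨w, hw, hwz⟩ := hRfst.symm.subset (mem_univ z.2)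
      exact ⟨(z.1, ⟨w.2, w, hw, rfl⟩), ⟨w.1, hw, hwz ▸ hz⟩, rfl⟩
  -- Hence `A` contains every `p`-fixed point of `M`, so `A = M`.
  have hAmem : ∀ x : M.carrier, limAct M.map p x = x → x ∈ A := by
    intro x hx
    obtain ⟨y', hy'R, hxy'⟩ := hfull.symm.subset
      (mem_univ ((x : X), (⟨A, _, hyA, rfl⟩ : Q.carrier)))
    have h1 := limAct_mem p hRcl hRinv hy'R
    rw [hΦ, limAct_prodMap] at h1
    dsimp only at h1
    rw [hpA] at h1
    have h2 := limAct_fiber_eq M.map S hJMcl hJMinv hF hp hy h1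
      (by rw [← limAct_add hSc, hp.idem]) hpA
    have hxJ : (x, y') ∈ JM := hxy'
    have h3 := limAct_mem p hJMcl hJMinv hxJ
    rw [limAct_prodMap, hx] at h3
    have h4 := limAct_mem_hyper M.map p ((hF _ _).2 h3)
    rwa [hx, ← h2] at h4
  have hMc := M.map.continuous
  obtain ⟨x₀⟩ := M.nonempty_carrier
  have hAuniv : ∀ x : M.carrier, x ∈ A := by
    have hsub : orbit M.map (limAct M.map p x₀) ⊆ A := by
      rintro _ ⟨k, -, rfl⟩
      refine hAmem _ ?_
      rw [limAct_iterate hMc, ← limAct_add hMc, hp.idem]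
    have := closure_minimal hsub A.isCompact.isClosed
    rw [(M.isMinimal_map _).closure_eq] at this
    exact fun x => this (mem_univ x)
  -- So `M × {y} ⊆ J`, and then `M × Y ⊆ J` by minimality of `Y`.
  have hyuniv : {y' : Y | ∀ x : M.carrier, (x, y') ∈ JM} = univ := by
    refine hS.isMinimal.eq_univ ?_ ⟨y, fun x => ?_⟩ ?_
    · simp only [ofPred_forall]
      exact isClosed_iInter fun x => hJMcl.preimage (Continuous.prodMk_right x)
    · have hle := limAct_mem p (x := (y, F y)) (isClosed_setOf_prod_subset hJMcl)
        (mapsTo_setOf_prod_subset M.map hJMinv) (fun x hx => (hF x y).1 hx)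
      rw [limAct_prodMap, hy] at hle
      exact hle x (hAuniv x)
    · intro y' hy' x
      obtain ⟨x', rfl⟩ := M.isMinimal_map.surjective hMc x
      exact hJMinv (hy' x')
  rintro ⟨x, y'⟩ ⟨hx, -⟩
  exact (hyuniv.symm.subset (mem_univ y')) ⟨x, hx⟩

end Quasifactor

/-! ### Words for a totally minimal subshift -/

section Words

variable {α : Type*}

/-- The word `w` occurs in every subword of `u` of length at least `L`. -/
def OccursSyndetically (L : ℕ) (w u : List α) : Prop :=
  ∀ v, v <:+: u → L ≤ v.length → w <:+: v

theorem isInfix_append_append {v x w y : List α} (h : v <:+: x ++ w ++ y) :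
    v <:+: x ++ w ∨ v <:+: w ++ y ∨ w <:+: v := by
  obtain ⟨s, t, h⟩ := h
  rw [List.append_assoc, List.append_assoc, List.append_eq_append_iff] at h
  obtain ⟨a, rfl, h⟩ | ⟨a, rfl, h⟩ := h
  · rw [← List.append_assoc, List.append_eq_append_iff] at h
    obtain ⟨b, h, -⟩ | ⟨b, rfl, -⟩ := h
    · exact .inl ⟨s, b, by simp [h]⟩
    · exact .inr (.inr ⟨a, b, rfl⟩)
  · exact .inr (.inl ⟨a, t, by simp [h]⟩)

/-- Gluing along a common occurrence of `w` does not increase the syndeticity constant. -/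
theorem OccursSyndetically.glue {L : ℕ} {w x y : List α} (hx : OccursSyndetically L w (x ++ w))
    (hy : OccursSyndetically L w (w ++ y)) : OccursSyndetically L w (x ++ w ++ y) := by
  intro v hv hL
  obtain h | h | h := isInfix_append_append hv
  exacts [hx v h hL, hy v h hL, h]

theorem occursSyndetically_of_length_le {L : ℕ} {w u : List α} (hw : w <:+: u)
    (hu : u.length ≤ L) : OccursSyndetically L w u := by
  intro v hv hL
  rwa [hv.eq_of_length_le (hu.trans hL)]

/-- The word `u` can be inserted between two occurrences of `w` without creating a gap between
occurrences of `w`, with respect to the constant `L`. -/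
def FillsGap (L : ℕ) (w u : List α) : Prop :=
  OccursSyndetically L w (w ++ u ++ w)

theorem fillsGap_of_length_le {L : ℕ} {w u : List α} (h : 2 * w.length + u.length ≤ L) :
    FillsGap L w u :=
  occursSyndetically_of_length_le ⟨[], u ++ w, by simp⟩ (by simp; omega)

/-- The word `u` starts and ends with `w`, and `w` occurs in it syndetically. -/
structure Anchored (L : ℕ) (w u : List α) : Prop where
  isPrefix : w <+: u
  isSuffix : w <:+ u
  occurs : OccursSyndetically L w u

theorem anchored_self {L : ℕ} {w : List α} (h : w.length ≤ L) : Anchored L w w :=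
  ⟨List.prefix_rfl, List.suffix_rfl, occursSyndetically_of_length_le List.infix_rfl h⟩

theorem Anchored.append {L : ℕ} {w u v s : List α} (hu : Anchored L w u) (hs : FillsGap L w s)
    (hv : Anchored L w v) : Anchored L w (u ++ s ++ v) := by
  obtain ⟨⟨a, ha⟩, ⟨m, rfl⟩, hu⟩ := hu
  obtain ⟨⟨n, rfl⟩, ⟨b, hb⟩, hv⟩ := hv
  refine ⟨⟨a ++ s ++ (w ++ n), by rw [← ha]; simp⟩, ⟨m ++ w ++ s ++ b, by rw [← hb]; simp⟩, ?_⟩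
  have h1 : OccursSyndetically L w ((w ++ s) ++ w ++ n) := OccursSyndetically.glue hs hv
  have h2 := OccursSyndetically.glue (x := m) (y := s ++ w ++ n) hu (by simpa using h1)
  simpa using h2

theorem FillsGap.append {L : ℕ} {w u v c : List α} (hw : w.length ≤ L) (hu : FillsGap L w u)
    (hc : Anchored L w c) (hv : FillsGap L w v) : FillsGap L w (u ++ c ++ v) := by
  have h := (((anchored_self hw).append hu hc).append hv (anchored_self hw)).occurs
  simpa [FillsGap] using h

/-- The word `u`, written from position `a` on, has its letters `true` at places of `A` only. -/
def Fits (A : Set ℕ) (a : ℕ) (u : List Bool) : Prop :=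
  ∀ i, u[i]? = some true → a + i ∈ A

theorem Fits.append {A : Set ℕ} {a : ℕ} {u v : List Bool} (hu : Fits A a u)
    (hv : Fits A (a + u.length) v) : Fits A a (u ++ v) := by
  intro i hi
  rw [List.getElem?_append] at hi
  split_ifs at hi with h
  · exact hu i hi
  · have := hv _ hi
    rwa [add_assoc, Nat.add_sub_cancel' (not_lt.1 h)] at this

theorem fits_of_forall {A : Set ℕ} {a : ℕ} {u : List Bool} (h : ∀ j < u.length, a + j ∈ A) :
    Fits A a u := by
  intro i hi
  obtain ⟨hi, -⟩ := List.getElem?_eq_some_iff.1 hi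
  exact h i hi

/-- Every interval carries a word with support in `A` that fills gaps for all the given pairs
of a word and a syndeticity constant. -/
def Fillable (A : Set ℕ) (P : Set (List Bool × ℕ)) : Prop :=
  ∀ a n, ∃ u : List Bool, u.length = n ∧ Fits A a u ∧ ∀ q ∈ P, FillsGap q.2 q.1 u

/-- `A` is thickly syndetic: for each `ℓ`, the intervals of length `ℓ` contained in `A` start at
a syndetic set of places. -/
def ThicklySyndetic (A : Set ℕ) : Prop :=
  ∀ ℓ, ∃ g, ∀ m, ∃ n, m ≤ n ∧ n ≤ m + g ∧ ∀ j < ℓ, n + j ∈ A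

/-- A further word `c` can be added to the list: it is written wherever there is room for it in
`A`, and the gaps are filled as before. The gaps are shorter than `g + c.length`, which gives the
constant `3 * c.length + g` for `c` itself; the earlier constants do not change. -/
theorem Fillable.insert {A : Set ℕ} {P : Set (List Bool × ℕ)} (hP : Fillable A P)
    (hlen : ∀ q ∈ P, q.1.length ≤ q.2) {c : List Bool} (hc : c ≠ [])
    (hanch : ∀ q ∈ P, Anchored q.2 q.1 c) {g : ℕ}
    (hg : ∀ m, ∃ n, m ≤ n ∧ n ≤ m + g ∧ ∀ j < c.length, n + j ∈ A) :
    Fillable A (insert (c, 3 * c.length + g) P) := by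
  have hcpos : 0 < c.length := List.length_pos_iff.2 hc
  intro a n
  induction n using Nat.strong_induction_on generalizing a with
  | _ n ih =>
  obtain ⟨b, hab, hbg, hbA⟩ := hg a
  by_cases hroom : b + c.length ≤ a + n
  · obtain ⟨u, hu, huA, huP⟩ := hP a (b - a)
    obtain ⟨v, hv, hvA, hvP⟩ := ih (a + n - (b + c.length)) (by omega) (b + c.length)
    refine ⟨u ++ c ++ v, by simp; omega, ?_, ?_⟩
    · refine Fits.append (huA.append (fits_of_forall ?_)) ?_
      · rwa [hu, Nat.add_sub_cancel' hab]
      · rwa [List.length_append, hu, ← add_assoc, Nat.add_sub_cancel' hab]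
    · rintro q (rfl | hq)
      · exact FillsGap.append (by dsimp only; omega)
          (fillsGap_of_length_le (by dsimp only; omega))
          (anchored_self (by dsimp only; omega)) (hvP _ (mem_insert _ _))
      · exact FillsGap.append (hlen q hq) (huP q hq) (hanch q hq)
          (hvP q (mem_insert_of_mem _ hq))
  · obtain ⟨u, hu, huA, huP⟩ := hP a n
    refine ⟨u, hu, huA, ?_⟩
    rintro q (rfl | hq)
    · exact fillsGap_of_length_le (by dsimp only; omega)
    · exact huP q hq

/-- A stage of the construction: a nonempty word, and a set of earlier words with syndeticity
constants. The earlier words can simultaneously be made syndetic on every interval by a word with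
support in `A`, and the word of the stage is anchored for each of them. The bound on the constants
leaves room for one letter between two occurrences of an earlier word. -/
structure Stage (A : Set ℕ) where
  earlier : Set (List Bool × ℕ)
  word : List Bool
  word_ne : word ≠ []
  fillable : Fillable A earlier
  anchored : ∀ q ∈ earlier, Anchored q.2 q.1 word
  length_le : ∀ q ∈ earlier, 2 * q.1.length + 1 ≤ q.2

/-- Copies of `c` are concatenated into blocks of length divisible by `N`, and a single letter
between consecutive blocks moves `c` through all residue classes modulo `N`. -/
theorem exists_word_residues {P : Set (List Bool × ℕ)} {c : List Bool}
    (hP : ∀ q ∈ P, Anchored q.2 q.1 c) (hlen : ∀ q ∈ P, 2 * q.1.length + 1 ≤ q.2) {N : ℕ}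
    (hN : 0 < N) :
    ∃ g : List Bool, (∀ q ∈ P, Anchored q.2 q.1 g) ∧
      ∀ r ≤ N, ∃ x y, g = x ++ c ++ y ∧ x.length ≡ r [MOD N] := by
  have hpow (m : ℕ) : ∃ g : List Bool, (∀ q ∈ P, Anchored q.2 q.1 g) ∧
      (∃ y, g = c ++ y) ∧ g.length = (m + 1) * c.length := by
    induction m with
    | zero => exact ⟨c, hP, ⟨[], by simp⟩, by simp⟩
    | succ m ih =>
      obtain ⟨g, hg, ⟨y, rfl⟩, hlg⟩ := ih
      refine ⟨c ++ y ++ [] ++ c, fun q hq => (hg q hq).append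
        (fillsGap_of_length_le (by have := hlen q hq; simp; omega)) (hP q hq),
        ⟨y ++ c, by simp⟩, ?_⟩
      rw [List.length_append, List.append_nil, hlg]
      ring
  obtain ⟨N, rfl⟩ : ∃ M, N = M + 1 := ⟨N - 1, by omega⟩
  obtain ⟨g₀, hg₀, ⟨y₀, rfl⟩, hlg₀⟩ := hpow N
  have hmod : (c ++ y₀).length ≡ 0 [MOD (N + 1)] := by
    rw [hlg₀]
    exact (Nat.modEq_zero_iff_dvd).2 (dvd_mul_right _ _)
  have key (i : ℕ) : ∃ g : List Bool, (∀ q ∈ P, Anchored q.2 q.1 g) ∧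
      g.length ≡ i [MOD (N + 1)] ∧
      ∀ r ≤ i, ∃ x y, g = x ++ c ++ y ∧ x.length ≡ r [MOD (N + 1)] := by
    induction i with
    | zero =>
      exact ⟨c ++ y₀, hg₀, hmod, fun r hr => ⟨[], y₀, rfl, by simp [Nat.le_zero.1 hr]; rfl⟩⟩
    | succ i ih =>
      obtain ⟨g, hg, hlg, hr⟩ := ih
      refine ⟨g ++ [false] ++ (c ++ y₀), fun q hq => (hg q hq).append
        (fillsGap_of_length_le (by have := hlen q hq; simp; omega)) (hg₀ q hq), ?_, ?_⟩
      · rw [List.length_append, List.length_append]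
        exact (hlg.add_right 1).add hmod
      · intro r hri
        obtain hri | rfl := Nat.le_succ_iff.1 hri
        · obtain ⟨x, y, rfl, hx⟩ := hr r hri
          exact ⟨x, y ++ [false] ++ (c ++ y₀), by simp, hx⟩
        · refine ⟨g ++ [false], y₀, by simp, ?_⟩
          rw [List.length_append]
          exact hlg.add_right 1
  obtain ⟨g, hg, -, hr⟩ := key (N + 1)
  exact ⟨g, hg, hr⟩

theorem Stage.exists_next {A : Set ℕ} (hA : ThicklySyndetic A) (s : Stage A) {N : ℕ}
    (hN : 0 < N) : ∃ t : Stage A, s.earlier ⊆ t.earlier ∧ (∃ L, (s.word, L) ∈ t.earlier) ∧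
      (∀ r, ∃ x y, t.word = x ++ s.word ++ y ∧ x.length ≡ r [MOD N]) ∧
      ∃ u, u.length = N ∧ Fits A 0 u ∧ u <:+: t.word := by
  obtain ⟨g, hg⟩ := hA s.word.length
  have hpos : 0 < s.word.length := List.length_pos_iff.2 s.word_ne
  set P := insert (s.word, 3 * s.word.length + g) s.earlier with hP
  have hfill : Fillable A P := s.fillable.insert
    (fun q hq => by have := s.length_le q hq; omega) s.word_ne s.anchored hg
  have hanch : ∀ q ∈ P, Anchored q.2 q.1 s.word := by
    rintro q (rfl | hq)
    · exact anchored_self (by dsimp only; omega)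
    · exact s.anchored q hq
  have hlen : ∀ q ∈ P, 2 * q.1.length + 1 ≤ q.2 := by
    rintro q (rfl | hq)
    · dsimp only; omega
    · exact s.length_le q hq
  obtain ⟨w, hw, hres⟩ := exists_word_residues hanch hlen hN
  obtain ⟨u, hu, huA, huP⟩ := hfill 0 N
  refine ⟨⟨P, w ++ u ++ s.word, by simp [s.word_ne], hfill,
    fun q hq => (hw q hq).append (huP q hq) (hanch q hq), hlen⟩, subset_insert _ _,
    ⟨_, mem_insert _ _⟩, fun r => ?_, u, hu, huA, ⟨w, s.word, rfl⟩⟩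
  obtain ⟨x, y, rfl, hx⟩ := hres (r % N) (Nat.mod_lt r hN).le
  exact ⟨x, y ++ u ++ s.word, by simp, hx.trans (Nat.mod_modEq r N)⟩

/-- A sequence of words, each syndetic in all later ones with a uniform constant, occurring in the
next one at places in every residue class, and such that long words supported in `A` occur. -/
theorem exists_words {A : Set ℕ} (hA : ThicklySyndetic A) : ∃ c : ℕ → List Bool,
    c 0 = [true] ∧ (∀ k, ∃ L, ∀ m, k < m → OccursSyndetically L (c k) (c m)) ∧
    (∀ k r, ∃ x y, c (k + 1) = x ++ c k ++ y ∧ x.length ≡ r [MOD (k + 1).factorial]) ∧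
    ∀ k, ∃ u, k ≤ u.length ∧ Fits A 0 u ∧ u <:+: c (k + 1) := by
  have hnext := fun (k : ℕ) (s : Stage A) => s.exists_next hA (k + 1).factorial_pos
  choose next h1 h2 h3 h4 using hnext
  let s₀ : Stage A := ⟨∅, [true], by simp, fun a n => ⟨List.replicate n false, by simp,
    fun i hi => by simp [List.getElem?_replicate] at hi, by simp⟩, by simp, by simp⟩
  let s : ℕ → Stage A := fun k => Nat.rec s₀ next k
  have hmono : Monotone fun k => (s k).earlier := monotone_nat_of_le_succ fun k => h1 k (s k)
  refine ⟨fun k => (s k).word, rfl, fun k => ?_, fun k r => h3 k (s k) r, fun k => ?_⟩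
  · obtain ⟨L, hL⟩ := h2 k (s k)
    exact ⟨L, fun m hm => ((s m).anchored _ (hmono (Nat.succ_le_of_lt hm) hL)).occurs⟩
  · obtain ⟨u, hu, hu'⟩ := h4 k (s k)
    exact ⟨u, hu ▸ (Nat.le_succ k).trans (Nat.self_le_factorial _), hu'⟩

end Words

/-! ### A totally minimal subshift supported on a thickly syndetic set -/

section Subshift

/-- The shift on one-sided binary sequences. -/
def shift (z : ℕ → Bool) : ℕ → Bool := fun n => z (n + 1)

theorem continuous_shift : Continuous shift :=
  continuous_pi fun n => continuous_apply (n + 1)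

theorem shift_iterate_apply (k : ℕ) (z : ℕ → Bool) (n : ℕ) : shift^[k] z n = z (k + n) := by
  induction k generalizing z with
  | zero => simp
  | succ k ih =>
    rw [Function.iterate_succ_apply, ih]
    exact congrArg z (by ring)

/-- The subword of length `n` of `z` that starts at `a`. -/
def window (z : ℕ → Bool) (a n : ℕ) : List Bool := List.ofFn fun i : Fin n => z (a + i)

@[simp]
theorem length_window (z : ℕ → Bool) (a n : ℕ) : (window z a n).length = n := by simp [window]

theorem getElem?_window {z : ℕ → Bool} {a n i : ℕ} (hi : i < n) :
    (window z a n)[i]? = some (z (a + i)) := by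
  simp [window, hi]

theorem eq_window_of_append {z : ℕ → Bool} {a n : ℕ} {x u y : List Bool}
    (h : window z a n = x ++ u ++ y) : u = window z (a + x.length) u.length := by
  have hn : n = x.length + u.length + y.length := by
    simpa [add_assoc] using congrArg List.length h
  refine List.ext_getElem? fun i => ?_
  by_cases hi : i < u.length
  · have h1 := getElem?_window (z := z) (a := a) (n := n) (i := x.length + i) (by omega)
    rw [h, List.append_assoc, List.getElem?_append_right (by omega), Nat.add_sub_cancel_left,
      List.getElem?_append_left hi] at h1
    rw [h1, getElem?_window hi, add_assoc]
  · rw [List.getElem?_eq_none (by omega), List.getElem?_eq_none (by simp; omega)]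

theorem window_shift (z : ℕ → Bool) (a n : ℕ) : window (shift z) a n = window z (a + 1) n := by
  unfold window shift
  congr 1
  funext i
  exact congrArg z (by ring)

/-- The subshift of all sequences whose subwords occur in the words `c k`. -/
def subshift (c : ℕ → List Bool) : Set (ℕ → Bool) :=
  {z | ∀ a n, ∃ k, window z a n <:+: c k}

theorem isClosed_subshift (c : ℕ → List Bool) : IsClosed (subshift c) := by
  simp only [subshift, ofPred_forall]
  refine isClosed_iInter fun a => isClosed_iInter fun n => ?_
  have hcont : Continuous fun (z : ℕ → Bool) (i : Fin n) => z (a + i) := by fun_prop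
  exact (isClosed_discrete {w : Fin n → Bool | ∃ k, List.ofFn w <:+: c k}).preimage hcont

theorem mapsTo_shift_subshift (c : ℕ → List Bool) :
    MapsTo shift (subshift c) (subshift c) := by
  intro z hz a n
  rw [window_shift]
  exact hz _ _

theorem isInfix_of_le {c : ℕ → List Bool} (hc : ∀ k, c k <:+: c (k + 1)) {k m : ℕ} (h : k ≤ m) :
    c k <:+: c m := by
  induction h with
  | refl => exact List.infix_rfl
  | step _ ih => exact ih.trans (hc _)

theorem exists_isInfix_window {c : ℕ → List Bool} (hc : ∀ k, c k <:+: c (k + 1))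
    (hsyn : ∀ k, ∃ L, ∀ m, k < m → OccursSyndetically L (c k) (c m)) {z : ℕ → Bool}
    (hz : z ∈ subshift c) (k a : ℕ) : ∃ L, c k <:+: window z a L := by
  obtain ⟨L, hL⟩ := hsyn k
  obtain ⟨m, hm⟩ := hz a L
  exact ⟨L, hL (max m (k + 1)) (by omega) _ (hm.trans (isInfix_of_le hc (le_max_left _ _)))
    (by simp)⟩

theorem tendsto_of_forall_lt {w : ℕ → ℕ → Bool} {z : ℕ → Bool}
    (h : ∀ M, ∀ i < M, w M i = z i) : Tendsto w atTop (𝓝 z) := by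
  rw [tendsto_pi_nhds]
  intro i
  refine tendsto_const_nhds.congr' ?_
  filter_upwards [eventually_gt_atTop i] with M hM
  exact (h M i hM).symm

theorem subshift_subset_closure_orbit {c : ℕ → List Bool}
    (hsyn : ∀ k, ∃ L, ∀ m, k < m → OccursSyndetically L (c k) (c m))
    (hres : ∀ k r, ∃ x y, c (k + 1) = x ++ c k ++ y ∧ x.length ≡ r [MOD (k + 1).factorial])
    {n : ℕ} (hn : 0 < n) {z : ℕ → Bool} (hz : z ∈ subshift c) :
    subshift c ⊆ closure (orbit shift^[n] z) := by
  intro z' hz'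
  have hc : ∀ k, c k <:+: c (k + 1) := fun k => by
    obtain ⟨x, y, h, -⟩ := hres k 0
    exact ⟨x, y, h.symm⟩
  have key (M : ℕ) : ∃ w ∈ orbit shift^[n] z, ∀ i < M, w i = z' i := by
    obtain ⟨k₀, hk₀⟩ := hz' 0 M
    obtain ⟨s, t, hst⟩ := hk₀.trans (isInfix_of_le hc (le_max_left k₀ n))
    set k := max k₀ n
    obtain ⟨L, p, q, hpq⟩ := exists_isInfix_window hc hsyn hz (k + 1) n
    -- The word `c k` is found at a place which brings the chosen subword of `z'` to a multiple
    -- of `n`.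
    obtain ⟨x, y, hxy, hx⟩ := hres k ((n + p.length + s.length) * (n - 1))
    have hdvd : n ∣ (k + 1).factorial :=
      Nat.dvd_factorial hn ((le_max_right k₀ n).trans (Nat.le_succ k))
    have hx' := hx.of_dvd hdvd
    have hwin : window z n L = (p ++ x ++ s) ++ window z' 0 M ++ (t ++ y ++ q) := by
      rw [← hpq, hxy, ← hst]
      simp
    have hw := eq_window_of_append hwin
    rw [length_window] at hw
    set b := n + (p ++ x ++ s).length with hb
    have hbn : n ∣ b := by
      rw [← Nat.modEq_zero_iff_dvd]
      have h1 : b = (n + p.length + s.length) + x.length := by simp [hb]; ring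
      rw [h1]
      refine (hx'.add_left _).trans ?_
      rw [Nat.modEq_zero_iff_dvd]
      obtain ⟨n, rfl⟩ : ∃ n', n = n' + 1 := ⟨n - 1, by omega⟩
      exact ⟨n + 1 + p.length + s.length, by simp; ring⟩
    obtain ⟨j, hj⟩ := hbn
    refine ⟨(shift^[n])^[j] z, ⟨j, ?_, rfl⟩, fun i hi => ?_⟩
    · refine Nat.pos_of_ne_zero ?_
      rintro rfl
      omega
    · rw [← Function.iterate_mul, shift_iterate_apply, ← hj]
      have h1 := getElem?_window (z := z') (a := 0) hi
      rw [hw, getElem?_window hi, zero_add] at h1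
      exact Option.some.inj h1
  choose w hw hwz using key
  exact mem_closure_of_tendsto (tendsto_of_forall_lt hwz) (.of_forall hw)

/-- A thickly syndetic set contains all the times at which some point of a totally minimal system
visits a certain nonempty open set. The system here is a subshift `Y`, the open set is
`{z ∈ Y | z 0 = true}`. -/
theorem exists_totallyMinimal_subshift {A : Set ℕ} (hA : ThicklySyndetic A) :
    ∃ Y : Set (ℕ → Bool), IsClosed Y ∧ MapsTo shift Y Y ∧
      (∀ n, 0 < n → ∀ z ∈ Y, Y ⊆ closure (orbit shift^[n] z)) ∧
      (∃ z ∈ Y, ∀ n, z n = true → n ∈ A) ∧ ∃ z ∈ Y, z 0 = true := by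
  obtain ⟨c, hc0, hsyn, hres, hfit⟩ := exists_words hA
  have hc : ∀ k, c k <:+: c (k + 1) := fun k => by
    obtain ⟨x, y, h, -⟩ := hres k 0
    exact ⟨x, y, h.symm⟩
  choose u hu huA huc using hfit
  -- A limit `z` of the words `u k`, along a nonprincipal ultrafilter.
  let w : ℕ → ℕ → Bool := fun k i => (u k)[i]?.getD false
  obtain ⟨z, hz⟩ : ∃ z, Tendsto w (hyperfilter ℕ : Filter ℕ) (𝓝 z) :=
    ⟨_, ((hyperfilter ℕ).map w).le_nhds_lim⟩
  have hev (i : ℕ) : ∀ᶠ k in (hyperfilter ℕ : Filter ℕ), w k i = z i :=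
    tendsto_pi_nhds.1 hz i ((isOpen_discrete {z i}).mem_nhds rfl)
  have hge (i : ℕ) : ∀ᶠ k in (hyperfilter ℕ : Filter ℕ), i ≤ k :=
    Nat.hyperfilter_le_atTop (eventually_ge_atTop i)
  have hzY : z ∈ subshift c := by
    intro a n
    have h1 : ∀ᶠ k in (hyperfilter ℕ : Filter ℕ), ∀ i ∈ Finset.range n, w k (a + i) = z (a + i) :=
      (Finset.eventually_all _).2 fun i _ => hev _
    obtain ⟨k, hk, hle⟩ := (h1.and (hge (a + n))).exists
    refine ⟨k + 1, .trans ?_ (huc k)⟩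
    have h2 : window z a n = ((u k).drop a).take n := by
      refine List.ext_getElem? fun i => ?_
      by_cases hi : i < n
      · rw [getElem?_window hi, List.getElem?_take_of_lt hi, List.getElem?_drop,
          ← hk i (Finset.mem_range.2 hi)]
        have h3 : a + i < (u k).length := by have := hu k; omega
        simp [w, h3]
      · rw [List.getElem?_eq_none (by simp; omega), List.getElem?_eq_none (by simp; omega)]
    rw [h2]
    exact (List.take_prefix _ _).isInfix.trans (List.drop_suffix _ _).isInfix
  refine ⟨subshift c, isClosed_subshift c, mapsTo_shift_subshift c,
    fun n hn z hz => subshift_subset_closure_orbit hsyn hres hn hz, ⟨z, hzY, fun n hn => ?_⟩, ?_⟩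
  · obtain ⟨k, hk⟩ := (hev n).exists
    have h1 : (u k)[n]? = some true := by
      rw [hn] at hk
      simpa [w, Option.getD_eq_iff] using hk
    simpa using huA k n h1
  · obtain ⟨L, p, q, hpq⟩ := exists_isInfix_window hc hsyn hzY 0 0
    refine ⟨shift^[p.length] z, (mapsTo_shift_subshift c).iterate _ hzY, ?_⟩
    have h1 := eq_window_of_append hpq.symm
    rw [hc0] at h1
    rw [shift_iterate_apply]
    simpa [window] using h1.symm

end Subshift

/-! ### Density of minimal points -/

section Density

variable {X : Type u} [TopologicalSpace X] {Y : Type v} [TopologicalSpace Y]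

theorem IsMinimal.of_factor {T : X → X} {S : Y → Y} (hT : IsMinimal T) {φ : X → Y}
    (hφ : Continuous φ) (hsurj : Function.Surjective φ) (h : Function.Semiconj φ T S) :
    IsMinimal S := by
  intro y
  obtain ⟨x, rfl⟩ := hsurj y
  refine (hsurj.denseRange.dense_image hφ (hT x)).mono ?_
  rintro _ ⟨_, ⟨n, hn, rfl⟩, rfl⟩
  exact ⟨n, hn, (h.iterate_right n x).symm⟩

/-- The test systems for disjointness may be taken in any lower universe and merely
metrizable. -/
theorem DisjointFromTM.disjoint {X : Type u} [TopologicalSpace X] {T : X → X}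
    (hT : DisjointFromTM T) {Y : Type} [TopologicalSpace Y] [CompactSpace Y] [MetrizableSpace Y]
    [Nonempty Y] {S : C(Y, Y)} (hS : IsTotallyMinimal S) : Disjoint T S := by
  let := metrizableSpaceMetric Y
  let S' : C(ULift.{u} Y, ULift.{u} Y) :=
    ⟨fun y => ⟨S y.down⟩, continuous_uliftUp.comp (S.continuous.comp continuous_uliftDown)⟩
  have hsemi : Function.Semiconj (ULift.up.{u} : Y → ULift.{u} Y) S S' := fun _ => rfl
  have hS' : IsTotallyMinimal S' := fun n hn =>
    (hS n hn).of_factor continuous_uliftUp ULift.up_surjective (hsemi.iterate_right n)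
  intro J hJ
  have h := hT (ULift.{u} Y) S' (hS'.isMinimal.surjective S'.continuous) hS'
    (Prod.map id ULift.down ⁻¹' J)
    { isClosed := hJ.isClosed.preimage (continuous_id.prodMap continuous_uliftDown)
      mapsTo := fun z hz => hJ.mapsTo hz
      fst_image := eq_univ_of_forall fun x => by
        obtain ⟨z, hz, rfl⟩ := hJ.fst_image.symm.subset (mem_univ x)
        exact ⟨(z.1, ⟨z.2⟩), hz, rfl⟩
      snd_image := eq_univ_of_forall fun y => by
        obtain ⟨z, hz, hzy⟩ := hJ.snd_image.symm.subset (mem_univ y.down)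
        exact ⟨(z.1, y), show (z.1, y.down) ∈ J from hzy ▸ hz, rfl⟩ }
  refine eq_univ_of_forall fun z => ?_
  exact h.symm.subset (mem_univ (z.1, ULift.up z.2))

theorem IsTransitive.exists_dense_orbit [CompactSpace X] [T2Space X] [Nonempty X]
    [SecondCountableTopology X] {T : X → X}
    (hc : Continuous T) (hT : IsTransitive T) : ∃ x, Dense (orbit T x) := by
  have hd : Dense (⋂ V ∈ countableBasis X, ⋃ n : ℕ, T^[n + 1] ⁻¹' V) := by
    refine dense_biInter_of_isOpen ?_ (countable_countableBasis X) ?_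
    · intro V hV
      exact isOpen_iUnion fun n => (isOpen_of_mem_countableBasis hV).preimage (hc.iterate _)
    · intro V hV
      rw [dense_iff_inter_open]
      intro U hU hUne
      obtain ⟨n, hn, x, hxU, hxV⟩ := hT U V hU hUne (isOpen_of_mem_countableBasis hV)
        (nonempty_of_mem_countableBasis hV)
      refine ⟨x, hxU, mem_iUnion.2 ⟨n - 1, ?_⟩⟩
      rwa [Nat.sub_add_cancel hn]
  obtain ⟨x, hx⟩ := hd.nonempty
  refine ⟨x, (isBasis_countableBasis X).dense_iff.2 fun V hV hne => ?_⟩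
  obtain ⟨n, hn⟩ := mem_iUnion.1 (mem_iInter₂.1 hx V hV)
  exact ⟨_, hn, n + 1, n.succ_pos, rfl⟩

/-- If the open set `U` meets no minimal set, then every orbit spends long times, syndetically
often, outside an open set `V` with closure in `U`. -/
theorem thicklySyndetic_of_disjoint_minimalSet [CompactSpace X] {T : C(X, X)} {U V : Set X}
    (hU : ∀ M : MinimalSet T, _root_.Disjoint M.carrier U) (hVU : closure V ⊆ U) (x : X) :
    ThicklySyndetic {n | T^[n] x ∉ V} := by
  intro ℓ
  by_contra! hcon
  choose m hm using hcon
  have hm' : ∀ g n, n ≤ g → ∃ j < ℓ, T^[n + j] (T^[m g] x) ∈ V := by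
    intro g n hn
    obtain ⟨j, hj, h⟩ := hm g (m g + n) (by omega) (by omega)
    refine ⟨j, hj, ?_⟩
    simp only [mem_ofPred_eq, not_not] at h
    rwa [← Function.iterate_add_apply, show n + j + m g = m g + n + j by ring]
  -- The limits of the points `T^(m g) x` return to `closure V` with gaps bounded by `ℓ`.
  set C : Set X := {y | ∀ n, ∃ j < ℓ, T^[n + j] y ∈ closure V} with hC
  have hcl (n : ℕ) : IsClosed {y : X | ∃ j < ℓ, T^[n + j] y ∈ closure V} := by
    have : {y : X | ∃ j < ℓ, T^[n + j] y ∈ closure V} =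
        ⋃ j ∈ Finset.range ℓ, T^[n + j] ⁻¹' closure V := by
      ext y
      simp
    rw [this]
    exact isClosed_biUnion_finset fun j _ =>
      isClosed_closure.preimage (T.continuous.iterate _)
  have hCcl : IsClosed C := by
    simp only [hC, ofPred_forall]
    exact isClosed_iInter hcl
  have hCne : C.Nonempty := by
    obtain ⟨y, hy⟩ : ∃ y, Tendsto (fun g => T^[m g] x) (hyperfilter ℕ : Filter ℕ) (𝓝 y) := by
      obtain ⟨y, -, hy⟩ := isCompact_univ.ultrafilter_le_nhds
        ((hyperfilter ℕ).map fun g => T^[m g] x) (by simp)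
      exact ⟨y, hy⟩
    refine ⟨y, fun n => (hcl n).mem_of_tendsto hy ?_⟩
    filter_upwards [Nat.hyperfilter_le_atTop (eventually_ge_atTop n)] with g hg
    obtain ⟨j, hj, h⟩ := hm' g n hg
    exact ⟨j, hj, subset_closure h⟩
  have hCinv : MapsTo T C C := by
    intro y hy n
    obtain ⟨j, hj, h⟩ := hy (n + 1)
    refine ⟨j, hj, ?_⟩
    rwa [← Function.iterate_succ_apply, show (n + j).succ = n + 1 + j by omega]
  obtain ⟨M, hM⟩ := exists_minimalSet_subset T hCcl hCne hCinv
  obtain ⟨y, hy⟩ := M.nonempty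
  obtain ⟨j, -, hj⟩ := hM hy 0
  exact disjoint_left.1 (hU M) (M.mapsTo.iterate _ hy) (hVU hj)

/-- A transitive system that is disjoint from all totally minimal systems has dense minimal
points. -/
theorem DisjointFromTM.exists_minimalSet_inter_nonempty {X : Type u} [MetricSpace X]
    [CompactSpace X] [Nonempty X] {T : C(X, X)} (htrans : IsTransitive T)
    (hT : DisjointFromTM T) {U : Set X} (hU : IsOpen U) (hne : U.Nonempty) :
    ∃ M : MinimalSet T, (M.carrier ∩ U).Nonempty := by
  by_contra! hcon
  obtain ⟨x₁, hx₁⟩ := hne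
  obtain ⟨V, hxV, hV, hVU⟩ : ∃ V, x₁ ∈ V ∧ IsOpen V ∧ closure V ⊆ U := by
    obtain ⟨ε, hε, h⟩ := Metric.nhds_basis_closedBall.mem_iff.1 (hU.mem_nhds hx₁)
    exact ⟨Metric.ball x₁ ε, Metric.mem_ball_self hε, Metric.isOpen_ball,
      Metric.closure_ball_subset_closedBall.trans h⟩
  obtain ⟨x₀, hx₀⟩ := htrans.exists_dense_orbit T.continuous
  obtain ⟨Y, hYcl, hYinv, hYmin, ⟨z₀, hz₀, hz₀A⟩, ⟨z₁, hz₁, hz₁0⟩⟩ :=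
    exists_totallyMinimal_subshift (thicklySyndetic_of_disjoint_minimalSet
      (fun M => disjoint_iff_inter_eq_empty.2 (hcon M)) hVU x₀)
  have hYcomp : CompactSpace Y := isCompact_iff_compactSpace.mp hYcl.isCompact
  have hYne : Nonempty Y := ⟨⟨z₀, hz₀⟩⟩
  let S : C(Y, Y) := ⟨hYinv.restrict shift Y Y, continuous_shift.restrict hYinv⟩
  have hS : IsTotallyMinimal S := by
    intro n hn z
    rw [Subtype.dense_iff]
    refine (hYmin n hn z z.2).trans (closure_mono ?_)
    rintro _ ⟨k, hk, rfl⟩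
    refine ⟨_, ⟨k, hk, rfl⟩, ?_⟩
    have hsemi : Function.Semiconj (Subtype.val : Y → (ℕ → Bool)) S shift := fun _ => rfl
    exact (hsemi.iterate_right n).iterate_right k z
  -- The pairs `(x, z)` such that `z` is supported on the times where `x` is outside `V`.
  let J : Set (X × Y) := {w | ∀ n, (w.2 : ℕ → Bool) n = true → T^[n] w.1 ∉ V}
  have hJcl : IsClosed J := by
    simp only [J, ofPred_forall]
    refine isClosed_iInter fun n => ?_
    simp only [imp_iff_not_or]
    refine IsClosed.union ?_ ?_
    · have hcont : Continuous fun w : X × Y => (w.2 : ℕ → Bool) n :=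
        (continuous_apply n).comp (continuous_subtype_val.comp continuous_snd)
      exact (isClosed_discrete {b : Bool | ¬ b = true}).preimage hcont
    · exact hV.isClosed_compl.preimage ((T.continuous.iterate n).comp continuous_fst)
  have hJinv : MapsTo (Prod.map T S) J J := by
    intro w hw n hn
    have := hw (n + 1) hn
    rwa [Function.iterate_succ_apply] at this
  have hJfst : Prod.fst '' J = univ := by
    have hcl : IsClosed (Prod.fst '' J) := (hJcl.isCompact.image continuous_fst).isClosed
    refine eq_univ_of_univ_subset ?_
    rw [← hx₀.closure_eq]
    refine closure_minimal ?_ hcl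
    rintro _ ⟨n, -, rfl⟩
    have h0 : ((x₀, ⟨z₀, hz₀⟩) : X × Y) ∈ J := fun n hn => hz₀A n hn
    refine ⟨_, hJinv.iterate n h0, ?_⟩
    rw [Prod.map_iterate]
    rfl
  have hfull := hT.disjoint hS J (isJoining_of_isMinimal hS.isMinimal hJcl hJinv hJfst)
  exact (hfull.symm.subset (mem_univ (x₁, ⟨z₁, hz₁⟩))) 0 hz₁0 hxV

end Density

/-! ### Families of minimal sets with dense union -/

section Main

variable {X : Type u}

theorem exists_seq_of_dense_iUnion [MetricSpace X] [CompactSpace X] [Nonempty X] {T : C(X, X)}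
    {p : MinimalSet T → Prop}
    (h : closure (⋃ (M : MinimalSet T) (_ : p M), M.carrier) = univ) :
    ∃ M : ℕ → MinimalSet T, closure (⋃ i, (M i).carrier) = univ ∧ ∀ i, p (M i) := by
  set D := ⋃ (M : MinimalSet T) (_ : p M), M.carrier with hD
  obtain ⟨t, ht, htc, htd⟩ := (IsSeparable.of_separableSpace D).exists_countable_dense_subset
  have htne : t.Nonempty := by
    rw [← closure_nonempty_iff]
    refine Nonempty.mono ?_ (univ_nonempty (α := X))
    rw [← h]
    exact closure_minimal htd isClosed_closure
  obtain ⟨f, rfl⟩ := htc.exists_eq_range htne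
  have hf : ∀ i, ∃ M : MinimalSet T, p M ∧ f i ∈ M.carrier := by
    intro i
    have := ht (mem_range_self i)
    simp only [hD, mem_iUnion] at this
    obtain ⟨M, hM, hi⟩ := this
    exact ⟨M, hM, hi⟩
  choose M hpM hM using hf
  refine ⟨M, eq_univ_of_univ_subset ?_, hpM⟩
  rw [← h]
  refine closure_minimal (htd.trans (closure_mono ?_)) isClosed_closure
  rintro _ ⟨i, rfl⟩
  exact mem_iUnion.2 ⟨i, hM i⟩

/-- A closed invariant set of a transitive system is nowhere dense or the whole space. -/
theorem IsTransitive.isNowhereDense_or_eq_univ [TopologicalSpace X] {T : X → X}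
    (hT : IsTransitive T) {C : Set X} (hC : IsClosed C) (hinv : MapsTo T C C) :
    IsNowhereDense C ∨ C = univ := by
  by_cases hint : (interior C).Nonempty
  · right
    rw [← hC.closure_eq, ← dense_iff_closure_eq, dense_iff_inter_open]
    intro V hV hVne
    obtain ⟨n, -, x, hx, hxV⟩ := hT _ V isOpen_interior hint hV hVne
    exact ⟨_, hxV, hinv.iterate n (interior_subset hx)⟩
  · left
    rw [hC.isNowhereDense_iff]
    exact not_nonempty_iff_eq_empty.1 hint

theorem mapsTo_tmPerp [TopologicalSpace X] (T : C(X, X)) : MapsTo T (tmPerp T) (tmPerp T) := by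
  refine MapsTo.closure ?_ T.continuous
  intro x hx
  simp only [mem_iUnion] at hx ⊢
  obtain ⟨M, hM, hxM⟩ := hx
  exact ⟨M, hM, M.mapsTo hxM⟩

/-- A minimal set disjoint from `(Y, S)` has its product with `Y` contained in every joining. -/
theorem MinimalSet.prod_univ_subset [TopologicalSpace X] [CompactSpace X] [T2Space X]
    {Y : Type v} [TopologicalSpace Y]
    [CompactSpace Y] [T2Space Y] {T : C(X, X)} {S : Y → Y} (M : MinimalSet T)
    (hS : IsMinimal S) (hM : Disjoint M.map S) {J : Set (X × Y)} (hJ : IsJoining T S J) :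
    M.carrier ×ˢ univ ⊆ J := by
  have h : {z : M.carrier × Y | ((z.1 : X), z.2) ∈ J} = univ := by
    refine hM _ (isJoining_of_isMinimal hS ?_ (fun z hz => hJ.mapsTo hz) ?_)
    · exact hJ.isClosed.preimage (by fun_prop)
    · refine eq_univ_of_forall fun x => ?_
      obtain ⟨z, hz, hzx⟩ := hJ.fst_image.symm.subset (mem_univ (x : X))
      exact ⟨(x, z.2), show ((x : X), z.2) ∈ J from hzx ▸ hz, rfl⟩
  rintro ⟨x, y⟩ ⟨hx, -⟩
  exact h.symm.subset (mem_univ (⟨x, hx⟩, y))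

theorem IsJoining.eq_univ_of_forall_subset [TopologicalSpace X]
    {Y : Type v} [TopologicalSpace Y] {T : C(X, X)} {S : Y → Y} {J : Set (X × Y)}
    (hJ : IsJoining T S J) {M : ℕ → MinimalSet T} (hd : closure (⋃ i, (M i).carrier) = univ)
    (h : ∀ i, (M i).carrier ×ˢ univ ⊆ J) : J = univ := by
  refine eq_univ_of_univ_subset ?_
  rw [← univ_prod_univ, ← hd, ← closure_univ (X := Y), ← closure_prod_eq]
  refine closure_minimal ?_ hJ.isClosed
  rw [iUnion_prod_const]
  exact iUnion_subset h

theorem exists_seq_of_isNowhereDense_tmPerp [MetricSpace X] [CompactSpace X] [Nonempty X]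
    {T : C(X, X)} (htrans : IsTransitive T) (hT : DisjointFromTM T)
    (hnd : IsNowhereDense (tmPerp T)) :
    ∃ N : ℕ → MinimalSet T, closure (⋃ i, (N i).carrier) = univ ∧
      ∀ i, ¬ DisjointFromTM (N i).map := by
  refine exists_seq_of_dense_iUnion (p := fun M => ¬ DisjointFromTM M.map) ?_
  rw [← dense_iff_closure_eq, dense_iff_inter_open]
  intro U hU hne
  have hcl : IsClosed (tmPerp T) := isClosed_closure
  have hUne : (U \ tmPerp T).Nonempty := by
    rw [nonempty_iff_ne_empty, Ne, sdiff_eq_empty]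
    intro hsub
    have := (hU.subset_interior_iff).2 hsub
    rw [hcl.isNowhereDense_iff.1 hnd] at this
    exact hne.not_subset_empty this
  obtain ⟨M, x, hxM, hxU, hxn⟩ :=
    hT.exists_minimalSet_inter_nonempty htrans (hU.sdiff hcl) hUne
  refine ⟨x, hxU, mem_iUnion₂.2 ⟨M, fun hM => hxn ?_, hxM⟩⟩
  exact subset_closure (mem_iUnion₂.2 ⟨M, hM, hxM⟩)

end Main

end TopDyn

theorem theoremD {X : Type*} [MetricSpace X] [CompactSpace X] [Nonempty X]
    (T : C(X, X)) (hT : Function.Surjective T) (htrans : TopDyn.IsTransitive T) :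
    TopDyn.DisjointFromTM T ↔
      ((∃ M : ℕ → TopDyn.MinimalSet T,
          closure (⋃ i, (M i).carrier) = Set.univ ∧
          ∀ i, TopDyn.DisjointFromTM (M i).map) ∨
        (IsNowhereDense (TopDyn.tmPerp T) ∧
          ∃ N : ℕ → TopDyn.MinimalSet T,
            closure (⋃ i, (N i).carrier) = Set.univ ∧
            ∀ i, ¬ TopDyn.DisjointFromTM (N i).map ∧
              ∀ Q : TopDyn.Quasifactor (N i).map,
                TopDyn.IsTotallyMinimal Q.map → TopDyn.Disjoint T Q.map)) := by
  constructor
  · intro hdisj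
    obtain hnd | huniv := htrans.isNowhereDense_or_eq_univ isClosed_closure
      (TopDyn.mapsTo_tmPerp T)
    · right
      obtain ⟨N, hN, hN'⟩ := TopDyn.exists_seq_of_isNowhereDense_tmPerp htrans hdisj hnd
      refine ⟨hnd, N, hN, fun i => ⟨hN' i, fun Q hQ => ?_⟩⟩
      exact hdisj Q.carrier Q.map (hQ.isMinimal.surjective Q.map.continuous) hQ
    · exact .inl (TopDyn.exists_seq_of_dense_iUnion huniv)
  · rintro (⟨M, hM, hMdisj⟩ | ⟨-, N, hN, hNdisj⟩) Y _ _ _ S hS hSTM J hJ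
    · exact hJ.eq_univ_of_forall_subset hM fun i =>
        (M i).prod_univ_subset hSTM.isMinimal (hMdisj i Y S hS hSTM) hJ
    · refine hJ.eq_univ_of_forall_subset hN fun i => ?_
      by_contra hne
      obtain ⟨Q, hQ, hQX⟩ := TopDyn.exists_quasifactor_not_disjoint (N i) hSTM hJ hne
      exact hQX ((hNdisj i).2 Q hQ)
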